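/- Let $\mathbb{F}_q$ be a finite field of characteristic greater than $2$, let $V$ be a vector space of dimension $n$ over $\mathbb{F}_q$, and let $\beta$ be an arbitrary bilinear form on $V$ with Gram matrix $B$ in some basis of $V$. The generalized Heisenberg group $H_\beta$ is the set $V\times\mathbb{F}_q$ with the multiplication $(v,r)\cdot(w,s)=(v+w,\;r+s+\beta(v,w))$. Put $\rho=\mathrm{rk}(B^T-B)$. Isaacs' conjecture holds for $H_\beta$: for all integers $n,\rho,e\ge 0$ there is a polynomial $P_{n,\rho,e}$ with nonnegative integer coefficients such that, for every finite field $\mathbb{F}_q$ of characteristic greater than $2$, every $n$-dimensional vector space $V$ over $\mathbb{F}_q$ and every bilinear form $\beta$ on $V$ with $\mathrm{rk}(B^T-B)=\rho$, the number of irreducible complex characters of $H_\beta$ of degree $q^e$ equals $P_{n,\rho,e}(q-1)$. Explicitly, $\rho$ is even, and every irreducible complex character of $H_\beta$ has degree $1$ or $q^{\rho/2}$. If $\rho\ne 0$, there are exactly $q^n$ irreducible characters of degree $1$ and exactly $(q-1)q^{n-\rho}$ irreducible characters of degree $q^{\rho/2}$. If $\rho=0$ (that is, $\beta$ is symmetric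 and $H_\beta$ is abelian), all irreducible characters have degree $1$ and there are exactly $q^n+(q-1)q^n=q^{n+1}$ of them. -/

import Mathlib

universe u v

/-- The underlying set `V × F` of the generalized Heisenberg group `H_β` of a bilinear form `β`
on an `F`-vector space `V`. -/
@[ext]
structure GenHeisenberg {F : Type u} {V : Type v} [Field F] [AddCommGroup V] [Module F V]
    (β : LinearMap.BilinForm F V) where
  vec : V
  scal : F

namespace GenHeisenberg

variable {F : Type u} {V : Type v} [Field F] [AddCommGroup V] [Module F V]
  {β : LinearMap.BilinForm F V}

/-- `(v, r) * (w, s) = (v + w, r + s + β(v, w))`. -/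
instance : Mul (GenHeisenberg β) where
  mul x y := ⟨x.vec + y.vec, x.scal + y.scal + β x.vec y.vec⟩

/-- The identity is `(0, 0)`. -/
instance : One (GenHeisenberg β) where
  one := ⟨0, 0⟩

/-- The inverse of `(v, r)` is `(-v, -r + β(v, v))`. -/
instance : Inv (GenHeisenberg β) where
  inv x := ⟨-x.vec, -x.scal + β x.vec x.vec⟩

@[simp] theorem mul_vec (x y : GenHeisenberg β) : (x * y).vec = x.vec + y.vec := rfl

@[simp] theorem mul_scal (x y : GenHeisenberg β) :
    (x * y).scal = x.scal + y.scal + β x.vec y.vec := rfl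

@[simp] theorem one_vec : (1 : GenHeisenberg β).vec = 0 := rfl

@[simp] theorem one_scal : (1 : GenHeisenberg β).scal = 0 := rfl

@[simp] theorem inv_vec (x : GenHeisenberg β) : x⁻¹.vec = -x.vec := rfl

@[simp] theorem inv_scal (x : GenHeisenberg β) : x⁻¹.scal = -x.scal + β x.vec x.vec := rfl

/-- The generalized Heisenberg group `H_β`. -/
instance : Group (GenHeisenberg β) :=
  Group.ofLeftAxioms
    (fun x y z => by
      ext
      · simp [add_assoc]
      · simp only [mul_scal, mul_vec, map_add, LinearMap.add_apply]
        ring)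
    (fun x => by ext <;> simp)
    (fun x => by ext <;> simp)

end GenHeisenberg

/-- The set `Irr G` of irreducible complex characters of a group `G`: the characters
(as functions `G → ℂ`) of the irreducible finite-dimensional complex representations of `G`. -/
def irrChars (G : Type*) [Group G] : Set (G → ℂ) :=
  {χ | ∃ (W : Type) (_ : AddCommGroup W) (_ : Module ℂ W) (_ : FiniteDimensional ℂ W)
    (ρ : Representation ℂ G W), ρ.IsIrreducible ∧ ρ.character = χ}

/-- The set of irreducible complex characters of `G` of degree `d`, where the degree of a character
`χ` is the dimension `χ(1)` of the corresponding representation. -/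
def irrCharsOfDegree (G : Type*) [Group G] (d : ℕ) : Set (G → ℂ) :=
  {χ | χ ∈ irrChars G ∧ χ 1 = (d : ℂ)}

/-- The rank of `Bᵀ - B`, where `B = (β(b i, b j))` is the Gram matrix of the bilinear form `β`
in the basis `b`. -/
noncomputable def altRank {F : Type u} {V : Type v} [Field F] [AddCommGroup V] [Module F V]
    {n : ℕ} (b : Module.Basis (Fin n) F V) (β : LinearMap.BilinForm F V) : ℕ :=
  ((LinearMap.BilinForm.toMatrix b β).transpose - LinearMap.BilinForm.toMatrix b β).rank

/-!
The proof is Clifford theory over the center, for which `H_β` is as simple as possible.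

Let `ω = β - βᵗ`; its rank is `ρ`. The commutator of `(v, r)` and `(w, s)` is `(0, ω(v, w))`, so the
center of `H_β` is `rad ω × F`, of order `q ^ (n - ρ) * q`. By Schur's lemma the center acts on an
irreducible representation through a linear character `l`
(`Representation.IsIrreducible.exists_centralCharacter`), and two cases arise.

If `l` is trivial on `F`, then all group elements act by commuting operators, so that the
representation has degree one and comes from a character of the group `V`; there are `q ^ n` of
these.

If `l` is nontrivial on `F`, then a noncentral `g` is conjugate to `z * g` for a central `z` with
`l z ≠ 1`, so the character vanishes off the center
(`IsNondegenerateCentral.character_eq_zero`). Orthonormality then forces its degree to be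
`√[H_β : Z(H_β)] = q ^ (ρ / 2)`, and the character is determined by `l`
(`IsNondegenerateCentral.character_eq`). Conversely a constituent of the representation induced
from `l` lies over `l`. The number of such `l` is
`q ^ (n - ρ) * q - q ^ (n - ρ) = (q - 1) * q ^ (n - ρ)`.

The two families are put together in `GenHeisenberg.irrChars_eq`. The rank `ρ` is even because a
skew-symmetric invertible matrix of odd size has `det M = -det M`, which is impossible in odd
characteristic. The counts are polynomials in `q - 1` with natural coefficients, since
`q ^ k = ((q - 1) + 1) ^ k`.
-/

/-! ### Central characters of irreducible representations -/

section CentralCharacter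

variable {G W : Type*} [Group G] [AddCommGroup W] [Module ℂ W]

/-- Schur's lemma, for endomorphisms commuting with the action. -/
theorem Representation.IsIrreducible.exists_eq_smul_one [FiniteDimensional ℂ W]
    {ρ : Representation ℂ G W} (hρ : ρ.IsIrreducible) (f : Module.End ℂ W)
    (hf : ∀ g, f * ρ g = ρ g * f) : ∃ c : ℂ, f = c • 1 := by
  obtain ⟨c, hc⟩ :=
    (Representation.IsIrreducible.algebraMap_intertwiningMap_bijective_of_isAlgClosed
      (ρ := ρ)).2 ⟨f, hf⟩
  refine ⟨c, ?_⟩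
  have := congrArg Representation.IntertwiningMap.toLinearMap hc
  refine this.symm.trans ?_
  ext w
  rfl

theorem Representation.IsIrreducible.nontrivial {ρ : Representation ℂ G W}
    (hρ : ρ.IsIrreducible) : Nontrivial W := by
  by_contra h
  rw [not_nontrivial_iff_subsingleton] at h
  obtain ⟨x, y, hxy⟩ := hρ.toNontrivial
  exact hxy (Subrepresentation.toSubmodule_injective (Subsingleton.elim _ _))

/-- The center of `G` acts on the representation `ρ` by the scalars `l`. -/
def HasCentralCharacter (ρ : Representation ℂ G W) (l : Subgroup.center G →* ℂˣ) : Prop :=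
  ∀ z : Subgroup.center G, ρ z = (l z : ℂ) • 1

variable [FiniteDimensional ℂ W]

/-- The center of `G` acts on an irreducible representation through a linear character. -/
theorem Representation.IsIrreducible.exists_centralCharacter {ρ : Representation ℂ G W}
    (hρ : ρ.IsIrreducible) :
    ∃ l : Subgroup.center G →* ℂˣ, HasCentralCharacter ρ l := by
  have := hρ.nontrivial
  have key : ∀ z : Subgroup.center G, ∃ c : ℂ, ρ z = c • 1 := fun z =>
    hρ.exists_eq_smul_one _ fun g => by
      rw [← map_mul, ← map_mul, Subgroup.mem_center_iff.mp z.2 g]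
  choose c hc using key
  have inj : ∀ a b : ℂ, a • (1 : Module.End ℂ W) = b • 1 → a = b := fun a b h =>
    smul_left_injective ℂ one_ne_zero h
  let f : Subgroup.center G →* ℂ :=
    { toFun := c
      map_one' := inj _ _ (by rw [← hc]; simp)
      map_mul' := fun x y => inj _ _ (by rw [← hc]; simp [hc, smul_smul, mul_comm]) }
  exact ⟨f.toHomUnits, hc⟩

/-- An irreducible representation by commuting operators is one-dimensional. -/
theorem Representation.IsIrreducible.finrank_eq_one_of_commute {ρ : Representation ℂ G W}
    (hρ : ρ.IsIrreducible) (h : ∀ g g', ρ g * ρ g' = ρ g' * ρ g) : Module.finrank ℂ W = 1 := by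
  have := hρ.nontrivial
  choose c hc using fun g => hρ.exists_eq_smul_one (ρ g) (h g)
  obtain ⟨w, hw⟩ := exists_ne (0 : W)
  let p : Subrepresentation ρ :=
    ⟨ℂ ∙ w, fun g v hv => by rw [hc]; exact Submodule.smul_mem _ _ hv⟩
  rcases hρ.eq_bot_or_eq_top p with hp | hp
  · refine absurd (Submodule.mem_span_singleton_self (R := ℂ) w) ?_
    rw [show (ℂ ∙ w) = ⊥ from congrArg Subrepresentation.toSubmodule hp]
    simpa using hw
  · rw [← finrank_top ℂ W,
      show (⊤ : Submodule ℂ W) = ℂ ∙ w from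
        (congrArg Subrepresentation.toSubmodule hp).symm]
    exact finrank_span_singleton hw

end CentralCharacter

/-! ### Linear characters -/

section Linear

variable {G : Type*} [Group G]

theorem coe_monoidHom_mem_irrChars (φ : G →* ℂˣ) : (fun g => (φ g : ℂ)) ∈ irrChars G := by
  let ρ : Representation ℂ G ℂ :=
    (Algebra.lmul ℂ ℂ : ℂ →* Module.End ℂ ℂ).comp ((Units.coeHom ℂ).comp φ)
  refine ⟨ℂ, _, _, inferInstance, ρ, ?_, ?_⟩
  · refine { exists_pair_ne := ⟨⊥, ⊤, fun h => ?_⟩, eq_bot_or_eq_top := fun p => ?_ }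
    · exact bot_ne_top (α := Submodule ℂ ℂ)
        (congrArg Subrepresentation.toSubmodule h)
    · exact (eq_bot_or_eq_top p.toSubmodule).imp
        (fun h => Subrepresentation.toSubmodule_injective h)
        (fun h => Subrepresentation.toSubmodule_injective h)
  · ext g
    change LinearMap.trace ℂ ℂ (LinearMap.mulLeft ℂ (φ g : ℂ)) = _
    rw [show LinearMap.mulLeft ℂ (φ g : ℂ) = (φ g : ℂ) • LinearMap.id by ext; simp]
    simp

/-- The character of a one-dimensional representation is multiplicative. -/
theorem Representation.exists_monoidHom_of_finrank_eq_one {W : Type*} [AddCommGroup W]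
    [Module ℂ W] [FiniteDimensional ℂ W] (ρ : Representation ℂ G W)
    (h : Module.finrank ℂ W = 1) :
    ∃ φ : G →* ℂˣ, ∀ g, ρ.character g = φ g := by
  have key (f : Module.End ℂ W) : f = LinearMap.trace ℂ W f • 1 := by
    obtain ⟨c, hc⟩ := (LinearMap.existsUnique_eq_smul_id_of_finrank_eq_one h f).exists
    rw [hc]
    simp [h, Module.End.one_eq_id]
  let f : G →* ℂ :=
    { toFun := ρ.character
      map_one' := by simp [h]
      map_mul' := fun x y => by
        simp only [Representation.character, map_mul]
        rw [key (ρ x)]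
        simp [h] }
  exact ⟨f.toHomUnits, fun g => rfl⟩

/-- The characters of a finite abelian group `A` that are nontrivial on the image of `f`. -/
theorem encard_comp_ne_one {A B : Type*} [CommGroup A] [Finite A] [Group B] (f : B →* A) :
    {l : A →* ℂˣ | l.comp f ≠ 1}.encard = ((Nat.card A - f.range.index : ℕ) : ℕ∞) := by
  have hcard := CommGroup.card_monoidHom_of_hasEnoughRootsOfUnity A ℂ
  have : Finite (A →* ℂˣ) := Nat.finite_of_card_ne_zero (by rw [hcard]; exact Nat.card_pos.ne')
  have hker := CommGroup.card_domRestrictHom_ker (G := A) ℂ f.range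
  have hset : {l : A →* ℂˣ | l.comp f ≠ 1} =
      ((MonoidHom.domRestrictHom f.range ℂˣ).ker : Set (A →* ℂˣ))ᶜ := by
    ext l
    refine not_congr ?_
    rw [SetLike.mem_coe, MonoidHom.mem_ker, MonoidHom.ext_iff, MonoidHom.ext_iff]
    simp
  rw [← (Set.toFinite _).cast_ncard_eq, hset, Set.ncard_compl, hcard, ← Nat.card_coe_set_eq]
  exact congrArg (fun m => ((Nat.card A - m : ℕ) : ℕ∞)) hker

end Linear

/-! ### Characters lying over a given character of the center -/

section OverCentral

variable {G : Type*} [Group G]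

open Classical in
/-- The function on `G` which equals `d * l` on the center and vanishes elsewhere. -/
noncomputable def centralExtension (d : ℕ) (l : Subgroup.center G →* ℂˣ) (g : G) : ℂ :=
  if h : g ∈ Subgroup.center G then d * (l ⟨g, h⟩ : ℂ) else 0

theorem centralExtension_coe (d : ℕ) (l : Subgroup.center G →* ℂˣ) (z : Subgroup.center G) :
    centralExtension d l z = d * (l z : ℂ) := by
  simp [centralExtension]

theorem centralExtension_one (d : ℕ) (l : Subgroup.center G →* ℂˣ) :
    centralExtension d l 1 = d := by
  simpa using centralExtension_coe d l 1

theorem centralExtension_injective {d : ℕ} (hd : d ≠ 0) :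
    Function.Injective (centralExtension (G := G) d) := by
  intro l l' h
  ext z
  have := congrFun h z
  rw [centralExtension_coe, centralExtension_coe] at this
  exact mul_left_cancel₀ (Nat.cast_ne_zero.mpr hd) this

/-- Every noncentral `g` is conjugate to some `z * g` with `z` central and `l z ≠ 1`. -/
def IsNondegenerateCentral (l : Subgroup.center G →* ℂˣ) : Prop :=
  ∀ g ∉ Subgroup.center G, ∃ h : G, ∃ z : Subgroup.center G, h * g * h⁻¹ = z * g ∧ l z ≠ 1

/-- The character vanishes off the center: conjugating `g` multiplies `ρ g` by a scalar
`l z ≠ 1` without changing its trace. -/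
theorem IsNondegenerateCentral.character_eq_zero {l : Subgroup.center G →* ℂˣ}
    (hl : IsNondegenerateCentral l) {W : Type*} [AddCommGroup W] [Module ℂ W]
    [FiniteDimensional ℂ W] {ρ : Representation ℂ G W} (hρ : HasCentralCharacter ρ l)
    {g : G} (hg : g ∉ Subgroup.center G) : ρ.character g = 0 := by
  obtain ⟨h, z, hz, hne⟩ := hl g hg
  have h1 : ρ.character (h * g * h⁻¹) = ρ.character g := ρ.char_conj g h
  rw [hz, Representation.character, map_mul, hρ z, smul_mul_assoc, one_mul, map_smul,
    smul_eq_mul] at h1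
  by_contra h0
  exact hne (Units.ext (mul_right_cancel₀ h0 (h1.trans (one_mul _).symm)))

/-- A nondegenerate central character is fully ramified: an irreducible representation above it
has degree `√[G : Z(G)]`, by the orthogonality relations. -/
theorem IsNondegenerateCentral.character_eq [Finite G] {l : Subgroup.center G →* ℂˣ}
    (hl : IsNondegenerateCentral l) {d : ℕ} (hd : d ^ 2 = (Subgroup.center G).index)
    {W : Type*} [AddCommGroup W] [Module ℂ W]
    [FiniteDimensional ℂ W] {ρ : Representation ℂ G W} (irr : ρ.IsIrreducible)
    (hρ : HasCentralCharacter ρ l) :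
    ρ.character = centralExtension d l := by
  classical
  have := Fintype.ofFinite G
  set m := Module.finrank ℂ W with hm
  have hz (z : Subgroup.center G) : ρ.character z = m * (l z : ℂ) := by
    simp [Representation.character, hρ z, mul_comm, hm]
  have hG : (Nat.card G : ℂ) ≠ 0 := Nat.cast_ne_zero.mpr Nat.card_pos.ne'
  have : Invertible (Nat.card G : ℂ) := invertibleOfNonzero hG
  have orth := Representation.char_orthonormal ρ ρ
  rw [if_pos ⟨Representation.Equiv.refl ρ⟩] at orth
  have sum : ∑ g : G, ρ.character g * ρ.character g⁻¹ =
      Nat.card (Subgroup.center G) * (m : ℂ) ^ 2 := by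
    rw [← Finset.sum_subset (Finset.subset_univ (Finset.univ.filter (· ∈ Subgroup.center G))),
      Finset.sum_congr rfl (g := fun _ => (m : ℂ) ^ 2), Finset.sum_const, nsmul_eq_mul]
    · rw [Nat.card_eq_fintype_card, Fintype.card_subtype]
    · intro g hg
      have hg := (Finset.mem_filter.mp hg).2
      have h1 := hz ⟨g, hg⟩
      have h2 := hz (⟨g, hg⟩⁻¹)
      simp only [Subgroup.coe_inv, map_inv] at h1 h2
      rw [h1, h2]
      have := (l ⟨g, hg⟩).mul_inv
      linear_combination (m : ℂ) ^ 2 * this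
    · intro g _ hg
      rw [hl.character_eq_zero hρ (by simpa using hg), zero_mul]
  have hmd : m ^ 2 = d ^ 2 := by
    rw [sum, inv_mul_eq_one₀ hG] at orth
    have h3 : Nat.card G = Nat.card (Subgroup.center G) * m ^ 2 := by exact_mod_cast orth
    rw [hd]
    rw [← (Subgroup.center G).card_mul_index] at h3
    exact (Nat.eq_of_mul_eq_mul_left Nat.card_pos h3).symm
  have hmd : m = d := Nat.pow_left_injective two_ne_zero hmd
  ext g
  by_cases hg : g ∈ Subgroup.center G
  · rw [hz ⟨g, hg⟩, centralExtension, dif_pos hg, hmd]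
  · rw [hl.character_eq_zero hρ hg, centralExtension, dif_neg hg]

/-- A nonzero representation with central character `l` contains an irreducible one. -/
theorem exists_irreducible_of_central (l : Subgroup.center G →* ℂˣ) (W : Type)
    [AddCommGroup W] [Module ℂ W] [FiniteDimensional ℂ W] [Nontrivial W]
    (ρ : Representation ℂ G W) (hρ : HasCentralCharacter ρ l) :
    ∃ (W' : Type) (_ : AddCommGroup W') (_ : Module ℂ W') (_ : FiniteDimensional ℂ W')
      (ρ' : Representation ℂ G W'), ρ'.IsIrreducible ∧ HasCentralCharacter ρ' l := by
  induction hn : Module.finrank ℂ W using Nat.strong_induction_on generalizing W with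
  | _ n ih =>
    by_cases irr : ρ.IsIrreducible
    · exact ⟨W, _, _, inferInstance, ρ, irr, hρ⟩
    · obtain ⟨p, hbot, htop⟩ : ∃ p : Subrepresentation ρ, p ≠ ⊥ ∧ p ≠ ⊤ := by
        by_contra! h
        refine irr { exists_pair_ne := ⟨⊥, ⊤, fun h => ?_⟩, eq_bot_or_eq_top := fun p => ?_ }
        · exact bot_ne_top (α := Submodule ℂ W)
            (congrArg Subrepresentation.toSubmodule h)
        · exact or_iff_not_imp_left.mpr (h p)
      have hbot' : p.toSubmodule ≠ ⊥ := fun h =>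
        hbot (Subrepresentation.toSubmodule_injective h)
      have htop' : p.toSubmodule ≠ ⊤ := fun h =>
        htop (Subrepresentation.toSubmodule_injective h)
      have : Nontrivial p.toSubmodule := Submodule.nontrivial_iff_ne_bot.mpr hbot'
      refine ih _ (hn ▸ Submodule.finrank_lt htop') p.toSubmodule p.toRepresentation ?_ rfl
      intro z
      ext w
      change ρ z w = _
      rw [hρ z]
      rfl

/-- Some irreducible representation has central character `l`: a constituent of the
representation induced from `l`. -/
theorem exists_irreducible_over [Finite G] (l : Subgroup.center G →* ℂˣ) :
    ∃ (W' : Type) (_ : AddCommGroup W') (_ : Module ℂ W') (_ : FiniteDimensional ℂ W')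
      (ρ' : Representation ℂ G W'), ρ'.IsIrreducible ∧ HasCentralCharacter ρ' l := by
  let U : Submodule ℂ (G → ℂ) :=
    { carrier := {f | ∀ (z : Subgroup.center G) g, f (g * z) = (l z : ℂ) * f g}
      add_mem' := fun ha hb z g => by simp [ha z g, hb z g, mul_add]
      zero_mem' := fun z g => by simp
      smul_mem' := fun c f hf z g => by simp [hf z g, mul_left_comm] }
  have hU (f : U) (z : Subgroup.center G) (g : G) : f.1 (g * z) = (l z : ℂ) * f.1 g := f.2 z g
  let σ : Representation ℂ G U :=
    { toFun := fun h =>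
        { toFun := fun f => ⟨fun g => f.1 (g * h), fun z g => by
            change f.1 (g * z * h) = _
            rw [mul_assoc, ← Subgroup.mem_center_iff.mp z.2 h, ← mul_assoc, hU f]⟩
          map_add' := fun _ _ => rfl
          map_smul' := fun _ _ => rfl }
      map_one' := by
        ext f g
        exact congrArg f.1 (mul_one g)
      map_mul' := fun h h' => by
        ext f g
        exact congrArg f.1 (mul_assoc g h h').symm }
  have hσ : HasCentralCharacter σ l := fun z => by
    ext f g
    exact hU f z g
  have : Nontrivial U := by
    refine ⟨⟨centralExtension 1 l, fun z g => ?_⟩, 0, fun h => ?_⟩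
    · by_cases hg : g ∈ Subgroup.center G
      · have := centralExtension_coe 1 l (⟨g, hg⟩ * z)
        rw [map_mul] at this
        simpa [centralExtension_coe 1 l ⟨g, hg⟩, mul_comm] using this
      · have hgz : g * z ∉ Subgroup.center G := by
          rwa [Subgroup.mul_mem_cancel_right _ z.2]
        simp [centralExtension, hg, hgz]
    · have := congrFun (congrArg Subtype.val h) 1
      simp [centralExtension_one] at this
  -- `irrChars` asks for a representation space in `Type`, so `U` is replaced by `ℂⁿ`.
  let e : U ≃ₗ[ℂ] (Fin (Module.finrank ℂ U) → ℂ) := (Module.finBasis ℂ U).equivFun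
  have := e.symm.toEquiv.nontrivial
  refine exists_irreducible_of_central l (Fin (Module.finrank ℂ U) → ℂ)
    ((e.conjRingEquiv : Module.End ℂ U →* _).comp σ) fun z => ?_
  refine LinearMap.ext fun w => ?_
  simp [hσ z]

/-- The only candidate for an irreducible character over a nondegenerate `l` is irreducible, since
there is an irreducible representation above `l`. -/
theorem IsNondegenerateCentral.centralExtension_mem_irrChars [Finite G]
    {l : Subgroup.center G →* ℂˣ} (hl : IsNondegenerateCentral l) {d : ℕ}
    (hd : d ^ 2 = (Subgroup.center G).index) : centralExtension d l ∈ irrChars G := by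
  obtain ⟨W, _, _, _, ρ, irr, hρ⟩ := exists_irreducible_over l
  exact ⟨W, _, _, inferInstance, ρ, irr, hl.character_eq hd irr hρ⟩

end OverCentral

/-! ### Skew-symmetric bilinear forms -/

section Skew

variable {F : Type*} {V : Type*} [Field F] [AddCommGroup V] [Module F V]

/-- Over a field of characteristic not two, a skew-symmetric form has even rank: on a complement
of its radical it has an invertible Gram matrix `M` with `Mᵀ = -M`, so that
`det M = (-1) ^ rank * det M`. -/
theorem LinearMap.BilinForm.even_finrank_range [FiniteDimensional F V]
    (ω : LinearMap.BilinForm F V) (hω : ∀ x y, ω x y = -ω y x) (hF : ringChar F ≠ 2) :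
    Even (Module.finrank F (LinearMap.range ω)) := by
  obtain ⟨C, hC⟩ := Submodule.exists_isCompl (LinearMap.ker ω)
  have hdim : Module.finrank F C = Module.finrank F (LinearMap.range ω) := by
    have h1 := Submodule.finrank_add_eq_of_isCompl hC
    have h2 := LinearMap.finrank_range_add_finrank_ker ω
    omega
  rw [← hdim]
  let c := Module.finBasis F C
  let M := LinearMap.toMatrix₂ c c (ω.domRestrict₁₂ C C)
  have hM : M.det ≠ 0 := by
    refine (LinearMap.separatingLeft_iff_det_ne_zero c).mp fun x hx => ?_
    have : (x : V) ∈ LinearMap.ker ω := by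
      rw [LinearMap.mem_ker]
      ext y
      obtain ⟨u, w, rfl⟩ : ∃ u : LinearMap.ker ω, ∃ w : C, (u : V) + w = y := by
        have := hC.sup_eq_top ▸ Submodule.mem_top (x := y)
        obtain ⟨u, hu, w, hw, h⟩ := Submodule.mem_sup.mp this
        exact ⟨⟨u, hu⟩, ⟨w, hw⟩, h⟩
      have h1 : ω x u = 0 := by
        rw [hω, LinearMap.mem_ker.mp u.2, LinearMap.zero_apply, neg_zero]
      have h2 : ω x w = 0 := hx w
      simp [h1, h2]
    exact Subtype.ext (Submodule.disjoint_def.mp hC.disjoint _ this x.2)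
  have hT : M.transpose = -M := by
    ext i j
    simp only [M, Matrix.transpose_apply, Matrix.neg_apply, LinearMap.toMatrix₂_apply,
      LinearMap.domRestrict₁₂_apply]
    exact hω (c j) (c i)
  have hdet : M.det = (-1) ^ Module.finrank F C * M.det := by
    conv_lhs => rw [← Matrix.det_transpose, hT, Matrix.det_neg, Fintype.card_fin]
  rw [← Nat.not_odd_iff_even]
  intro hodd
  rw [hodd.neg_one_pow] at hdet
  exact Ring.neg_one_ne_one_of_char_ne_two hF
    (mul_right_cancel₀ hM (hdet.symm.trans (one_mul _).symm))

/-- The form `(v, w) ↦ β(v, w) - β(w, v)`, which describes the commutators in `H_β`. -/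
def commForm (β : LinearMap.BilinForm F V) : LinearMap.BilinForm F V := β - LinearMap.flip β

@[simp] theorem commForm_apply (β : LinearMap.BilinForm F V) (v w : V) :
    commForm β v w = β v w - β w v := rfl

theorem altRank_eq_finrank_range {n : ℕ} (b : Module.Basis (Fin n) F V)
    (β : LinearMap.BilinForm F V) :
    altRank b β = Module.finrank F (LinearMap.range (commForm β)) := by
  have : (LinearMap.BilinForm.toMatrix b β).transpose - LinearMap.BilinForm.toMatrix b β =
      LinearMap.toMatrix b b.dualBasis (commForm β) := by
    ext i j
    simp [LinearMap.toMatrix_apply, LinearMap.BilinForm.toMatrix_apply]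
  rw [altRank, this, Matrix.rank_eq_finrank_range_toLin _ b.dualBasis b,
    Matrix.toLin_toMatrix]

theorem altRank_add_finrank_ker {n : ℕ} (b : Module.Basis (Fin n) F V)
    (β : LinearMap.BilinForm F V) :
    altRank b β + Module.finrank F (LinearMap.ker (commForm β)) = n := by
  have := Module.Finite.of_basis b
  rw [altRank_eq_finrank_range, LinearMap.finrank_range_add_finrank_ker,
    Module.finrank_eq_card_basis b, Fintype.card_fin]

theorem even_altRank {n : ℕ} (b : Module.Basis (Fin n) F V)
    (β : LinearMap.BilinForm F V) (hF : ringChar F ≠ 2) : Even (altRank b β) := by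
  have := Module.Finite.of_basis b
  rw [altRank_eq_finrank_range]
  exact (commForm β).even_finrank_range (fun x y => by simp) hF

end Skew

/-! ### The center of the generalized Heisenberg group -/

namespace GenHeisenberg

variable {F : Type u} {V : Type v} [Field F] [AddCommGroup V] [Module F V]
  {β : LinearMap.BilinForm F V}

/-- The underlying set of `H_β` is `V × F`. -/
def equivProd (β : LinearMap.BilinForm F V) : GenHeisenberg β ≃ V × F where
  toFun g := (g.vec, g.scal)
  invFun p := ⟨p.1, p.2⟩
  left_inv _ := rfl
  right_inv _ := rfl

theorem mem_center_iff {g : GenHeisenberg β} :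
    g ∈ Subgroup.center (GenHeisenberg β) ↔ g.vec ∈ LinearMap.ker (commForm β) := by
  rw [Subgroup.mem_center_iff, LinearMap.mem_ker]
  constructor
  · intro h
    ext w
    have := congrArg scal (h ⟨w, 0⟩)
    simp only [mul_scal, zero_add, add_zero, add_right_inj] at this
    simp [this]
  · intro h x
    have := LinearMap.congr_fun h x.vec
    rw [commForm_apply, LinearMap.zero_apply, sub_eq_zero] at this
    ext
    · simp [add_comm]
    · simp [this, add_comm]

/-- The center of `H_β` is the product of the radical of `commForm β` with `F`. -/
def centerEquiv (β : LinearMap.BilinForm F V) :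
    Subgroup.center (GenHeisenberg β) ≃ LinearMap.ker (commForm β) × F where
  toFun g := (⟨g.1.vec, mem_center_iff.mp g.2⟩, g.1.scal)
  invFun p := ⟨⟨p.1, p.2⟩, mem_center_iff.mpr p.1.2⟩
  left_inv _ := rfl
  right_inv _ := rfl

/-- The embedding `r ↦ (0, r)` of `F` into the center of `H_β`. -/
def scalHom (β : LinearMap.BilinForm F V) :
    Multiplicative F →* Subgroup.center (GenHeisenberg β) where
  toFun r := ⟨⟨0, r.toAdd⟩, mem_center_iff.mpr (Submodule.zero_mem _)⟩
  map_one' := rfl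
  map_mul' r s := by
    apply Subtype.ext
    ext <;> simp

theorem scalHom_injective (β : LinearMap.BilinForm F V) : Function.Injective (scalHom β) :=
  fun _ _ h => congrArg (fun z => scal z.1) h

theorem eq_scalHom_mul (g : GenHeisenberg β) :
    g = (scalHom β (Multiplicative.ofAdd g.scal) : GenHeisenberg β) * ⟨g.vec, 0⟩ := by
  ext <;> simp [scalHom]

theorem mul_eq_scalHom_mul (g h : GenHeisenberg β) :
    h * g = scalHom β (Multiplicative.ofAdd (commForm β h.vec g.vec)) * (g * h) := by
  ext
  · simp [scalHom, add_comm]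
  · simp [scalHom]
    ring

/-- A character of the center that is nontrivial on `F` is nondegenerate, as the commutators of a
noncentral element fill `F`. -/
theorem isNondegenerateCentral {l : Subgroup.center (GenHeisenberg β) →* ℂˣ}
    (hl : l.comp (scalHom β) ≠ 1) : IsNondegenerateCentral l := by
  intro g hg
  obtain ⟨r, hr⟩ : ∃ r, l (scalHom β r) ≠ 1 := by
    by_contra! h
    exact hl (MonoidHom.ext h)
  obtain ⟨w, hw⟩ : ∃ w, commForm β w g.vec ≠ 0 := by
    by_contra! h
    refine hg (mem_center_iff.mpr ?_)
    ext w
    have := h w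
    rw [commForm_apply] at this
    simp only [commForm_apply, LinearMap.zero_apply]
    rw [← neg_sub, this, neg_zero]
  refine ⟨⟨(r.toAdd / commForm β w g.vec) • w, 0⟩, scalHom β r, ?_, hr⟩
  rw [mul_inv_eq_iff_eq_mul, mul_eq_scalHom_mul, mul_assoc]
  congr 4
  rw [map_smul, LinearMap.smul_apply, smul_eq_mul, div_mul_cancel₀ _ hw]
  rfl

/-! ### The irreducible characters of the generalized Heisenberg group -/

/-- The linear character of `H_β` obtained from a character of the group `V`. -/
noncomputable def linearChar (β : LinearMap.BilinForm F V) (φ : Multiplicative V →* ℂˣ)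
    (g : GenHeisenberg β) : ℂ :=
  φ (Multiplicative.ofAdd g.vec)

theorem linearChar_injective (β : LinearMap.BilinForm F V) :
    Function.Injective (linearChar β) := by
  intro φ φ' h
  refine MonoidHom.ext fun v => Units.ext ?_
  exact congrFun h ⟨v.toAdd, 0⟩

theorem linearChar_one (φ : Multiplicative V →* ℂˣ) : linearChar β φ 1 = 1 := by
  simp [linearChar]

theorem linearChar_mem_irrChars (φ : Multiplicative V →* ℂˣ) :
    linearChar β φ ∈ irrChars (GenHeisenberg β) :=
  coe_monoidHom_mem_irrChars
    (φ.comp { toFun := fun g : GenHeisenberg β => Multiplicative.ofAdd g.vec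
              map_one' := rfl
              map_mul' := fun _ _ => rfl })

/-- An irreducible representation on which `F` acts trivially is a representation of the
abelian group `V`. -/
theorem exists_character_eq_linearChar {W : Type*} [AddCommGroup W] [Module ℂ W]
    [FiniteDimensional ℂ W] {ρ : Representation ℂ (GenHeisenberg β) W} (irr : ρ.IsIrreducible)
    (h : ∀ r, ρ (scalHom β r) = 1) : ∃ φ, ρ.character = linearChar β φ := by
  have h1 : Module.finrank ℂ W = 1 := irr.finrank_eq_one_of_commute fun g g' => by
    rw [← map_mul, mul_eq_scalHom_mul, map_mul, h, one_mul, map_mul]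
  obtain ⟨φ, hφ⟩ := ρ.exists_monoidHom_of_finrank_eq_one h1
  have h2 (r) : φ (scalHom β r) = 1 := by
    apply Units.ext
    rw [← hφ, Representation.character, h]
    simp [h1]
  have h3 (g : GenHeisenberg β) : φ g = φ ⟨g.vec, 0⟩ := by
    conv_lhs => rw [eq_scalHom_mul g, map_mul, h2, one_mul]
  refine ⟨{ toFun := fun v => φ ⟨v.toAdd, 0⟩, map_one' := map_one φ,
            map_mul' := fun v w => ?_ }, ?_⟩
  · rw [← map_mul, h3 (_ * _)]
    rfl
  · ext g
    rw [hφ, h3]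
    rfl

/-- Clifford theory for `H_β`: an irreducible character is linear or fully ramified over the
center, according to whether `F` acts trivially or not. -/
theorem irrChars_eq [Finite (GenHeisenberg β)] {d : ℕ}
    (hd : d ^ 2 = (Subgroup.center (GenHeisenberg β)).index) :
    irrChars (GenHeisenberg β) =
      Set.range (linearChar β) ∪ centralExtension d '' {l | l.comp (scalHom β) ≠ 1} := by
  apply Set.Subset.antisymm
  · rintro _ ⟨W, _, _, _, ρ, irr, rfl⟩
    obtain ⟨l, hl⟩ := irr.exists_centralCharacter
    by_cases h : l.comp (scalHom β) = 1
    · obtain ⟨φ, hφ⟩ := exists_character_eq_linearChar irr fun r => by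
        rw [hl, show l (scalHom β r) = 1 from DFunLike.congr_fun h r, Units.val_one, one_smul]
      exact Or.inl ⟨φ, hφ.symm⟩
    · exact Or.inr ⟨l, h, ((isNondegenerateCentral h).character_eq hd irr hl).symm⟩
  · rintro _ (⟨φ, rfl⟩ | ⟨l, hl, rfl⟩)
    · exact linearChar_mem_irrChars φ
    · exact (isNondegenerateCentral hl).centralExtension_mem_irrChars hd

theorem disjoint_linear_central (β : LinearMap.BilinForm F V) (d : ℕ) :
    Disjoint (Set.range (linearChar β)) (centralExtension d '' {l | l.comp (scalHom β) ≠ 1}) := by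
  rw [Set.disjoint_left]
  rintro _ ⟨φ, rfl⟩ ⟨l, hl, h⟩
  refine hl (MonoidHom.ext fun r => Units.ext ?_)
  have h1 := congrFun h 1
  rw [centralExtension_one, linearChar_one] at h1
  have h2 := congrFun h (scalHom β r)
  rw [centralExtension_coe, h1, one_mul] at h2
  rw [MonoidHom.comp_apply, h2]
  exact linearChar_one (β := β) φ

/-! ### Counting the irreducible characters -/

section Count

variable [Fintype F]

theorem encard_range_linearChar {n : ℕ} (b : Module.Basis (Fin n) F V)
    (β : LinearMap.BilinForm F V) :
    (Set.range (linearChar β)).encard = ((Fintype.card F ^ n : ℕ) : ℕ∞) := by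
  have := Module.Finite.of_basis b
  have : Finite V := Module.finite_of_finite F
  rw [← Set.image_univ, (linearChar_injective β).encard_image, Set.encard_univ]
  have hcard := CommGroup.card_monoidHom_of_hasEnoughRootsOfUnity (Multiplicative V) ℂ
  have hV : Nat.card (Multiplicative V) = Fintype.card F ^ n := by
    rw [Nat.card_congr Multiplicative.toAdd, Module.natCard_eq_pow_finrank (K := F),
      Module.finrank_eq_card_basis b, Fintype.card_fin, Nat.card_eq_fintype_card]
  have : Finite (Multiplicative V →* ℂˣ) := Nat.finite_of_card_ne_zero
    (by rw [hcard]; exact Nat.card_pos.ne')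
  rw [ENat.card_eq_coe_natCard, hcard, hV]

theorem card_center {n : ℕ} (b : Module.Basis (Fin n) F V) (β : LinearMap.BilinForm F V) :
    Nat.card (Subgroup.center (GenHeisenberg β)) =
      Fintype.card F ^ (n - altRank b β) * Fintype.card F := by
  have := Module.Finite.of_basis b
  rw [Nat.card_congr (centerEquiv β), Nat.card_prod, Module.natCard_eq_pow_finrank (K := F),
    Nat.card_eq_fintype_card, ← Nat.eq_sub_of_add_eq' (altRank_add_finrank_ker b β)]

theorem sq_eq_index_center {n : ℕ} (b : Module.Basis (Fin n) F V) (β : LinearMap.BilinForm F V)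
    (hF : ringChar F ≠ 2) :
    (Fintype.card F ^ (altRank b β / 2)) ^ 2 = (Subgroup.center (GenHeisenberg β)).index := by
  have := Module.Finite.of_basis b
  have h := (Subgroup.center (GenHeisenberg β)).card_mul_index
  have hn := altRank_add_finrank_ker b β
  have hq : 0 < Fintype.card F := Fintype.card_pos
  rw [card_center b, Nat.card_congr (equivProd β), Nat.card_prod,
    Module.natCard_eq_pow_finrank (K := F) (V := V), Module.finrank_eq_card_basis b,
    Fintype.card_fin, Nat.card_eq_fintype_card] at h
  rw [← pow_mul, Nat.div_mul_cancel (even_altRank b β hF).two_dvd]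
  refine (Nat.eq_of_mul_eq_mul_left (Nat.mul_pos (Nat.pow_pos hq) hq) (h.trans ?_)).symm
  rw [mul_right_comm, ← pow_add, Nat.sub_add_cancel (by omega)]

open scoped IsMulCommutative in
/-- The characters of the center, less those that factor through its quotient by `F`. -/
theorem encard_image_centralExtension {n : ℕ} (b : Module.Basis (Fin n) F V)
    (β : LinearMap.BilinForm F V) {d : ℕ} (hd : d ≠ 0) :
    (centralExtension d '' {l | l.comp (scalHom β) ≠ 1}).encard =
      (((Fintype.card F - 1) * Fintype.card F ^ (n - altRank b β) : ℕ) : ℕ∞) := by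
  have := Module.Finite.of_basis b
  have : Finite V := Module.finite_of_finite F
  have : Finite (GenHeisenberg β) := Finite.of_equiv _ (equivProd β).symm
  have hquot : (scalHom β).range.index = Fintype.card F ^ (n - altRank b β) := by
    have h1 := (scalHom β).range.index_mul_card
    rw [card_center b, ← Nat.card_congr (MonoidHom.ofInjective (scalHom_injective β)).toEquiv,
      Nat.card_congr Multiplicative.toAdd, Nat.card_eq_fintype_card (α := F)] at h1
    exact Nat.eq_of_mul_eq_mul_right Fintype.card_pos h1
  rw [(centralExtension_injective hd).encard_image]
  refine (encard_comp_ne_one (A := Subgroup.center (GenHeisenberg β)) (scalHom β)).trans ?_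
  rw [hquot, card_center b, Nat.sub_mul, one_mul, mul_comm]

end Count

end GenHeisenberg

open GenHeisenberg in
/-- The degrees of the irreducible characters of `H_β`, and the number of characters of each
degree. For `ρ = 0` both families of characters are linear. -/
theorem irrChars_description (F : Type u) [Field F] [Fintype F] (V : Type v) [AddCommGroup V]
    [Module F V] (n : ℕ) (b : Module.Basis (Fin n) F V) (β : LinearMap.BilinForm F V)
    (hF : 2 < ringChar F) :
    Even (altRank b β) ∧
      (∀ χ ∈ irrChars (GenHeisenberg β),
        χ 1 = 1 ∨ χ 1 = (Fintype.card F : ℂ) ^ (altRank b β / 2)) ∧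
      (altRank b β ≠ 0 →
        (irrCharsOfDegree (GenHeisenberg β) 1).encard = ((Fintype.card F ^ n : ℕ) : ℕ∞) ∧
        (irrCharsOfDegree (GenHeisenberg β) (Fintype.card F ^ (altRank b β / 2))).encard =
          (((Fintype.card F - 1) * Fintype.card F ^ (n - altRank b β) : ℕ) : ℕ∞)) ∧
      (altRank b β = 0 →
        (irrCharsOfDegree (GenHeisenberg β) 1).encard =
          ((Fintype.card F ^ n + (Fintype.card F - 1) * Fintype.card F ^ n : ℕ) : ℕ∞)) := by
  have := Module.Finite.of_basis b
  have : Finite V := Module.finite_of_finite F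
  have : Finite (GenHeisenberg β) := Finite.of_equiv _ (equivProd β).symm
  have hq : 1 < Fintype.card F := Fintype.one_lt_card
  have heven := even_altRank b β hF.ne'
  set d := Fintype.card F ^ (altRank b β / 2) with hd
  have hd0 : d ≠ 0 := (pow_pos (by omega) _).ne'
  have hirr := irrChars_eq (sq_eq_index_center b β hF.ne')
  rw [← hd] at hirr
  have hdeg : ∀ χ ∈ irrChars (GenHeisenberg β),
      (χ ∈ Set.range (linearChar β) ∧ χ 1 = 1) ∨
      (χ ∈ centralExtension d '' {l | l.comp (scalHom β) ≠ 1} ∧ χ 1 = d) := by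
    rw [hirr]
    rintro χ (h | h)
    · refine Or.inl ⟨h, ?_⟩
      obtain ⟨φ, rfl⟩ := h
      exact linearChar_one φ
    · refine Or.inr ⟨h, ?_⟩
      obtain ⟨l, -, rfl⟩ := h
      exact centralExtension_one d l
  have hlin : Set.range (linearChar β) ⊆ irrCharsOfDegree (GenHeisenberg β) 1 := by
    rintro _ ⟨φ, rfl⟩
    exact ⟨linearChar_mem_irrChars φ, by rw [linearChar_one, Nat.cast_one]⟩
  have hcen : centralExtension d '' {l | l.comp (scalHom β) ≠ 1} ⊆
      irrCharsOfDegree (GenHeisenberg β) d := by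
    intro χ h
    refine ⟨hirr ▸ Or.inr h, ?_⟩
    obtain ⟨l, -, rfl⟩ := h
    exact centralExtension_one d l
  refine ⟨heven, fun χ hχ => ?_, fun h0 => ?_, fun h0 => ?_⟩
  · rw [← Nat.cast_pow]
    exact (hdeg χ hχ).imp And.right And.right
  · have hd1 : (d : ℂ) ≠ 1 := by
      have : 1 < d := Nat.one_lt_pow (by obtain ⟨k, hk⟩ := heven; omega) hq
      exact_mod_cast this.ne'
    rw [← encard_range_linearChar b β, ← encard_image_centralExtension b β hd0]
    constructor
    · congr 1
      refine Set.Subset.antisymm (fun χ hχ => ?_) hlin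
      exact ((hdeg χ hχ.1).resolve_right fun h => hd1 (h.2.symm.trans (by simpa using hχ.2))).1
    · congr 1
      refine Set.Subset.antisymm (fun χ hχ => ?_) hcen
      exact ((hdeg χ hχ.1).resolve_left fun h => hd1 (hχ.2.symm.trans h.2)).1
  · have hd1 : d = 1 := by rw [hd, h0, Nat.zero_div, pow_zero]
    have : irrCharsOfDegree (GenHeisenberg β) 1 = Set.range (linearChar β) ∪
        centralExtension d '' {l | l.comp (scalHom β) ≠ 1} :=
      Set.Subset.antisymm (fun χ hχ => hirr ▸ hχ.1) (Set.union_subset hlin (hd1 ▸ hcen))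
    rw [this, Set.encard_union_eq (disjoint_linear_central β d), encard_range_linearChar b,
      encard_image_centralExtension b β hd0, h0, Nat.sub_zero, Nat.cast_add]

theorem corollary3p2 :
    -- Isaacs' conjecture: one polynomial in `q - 1` with coefficients in `ℕ` for all `q`
    (∀ n r e : ℕ, ∃ P : Polynomial ℕ,
      ∀ (F : Type u) [Field F] [Fintype F] (V : Type v) [AddCommGroup V] [Module F V]
        (b : Module.Basis (Fin n) F V) (β : LinearMap.BilinForm F V),
        2 < ringChar F → altRank b β = r →
          (irrCharsOfDegree (GenHeisenberg β) (Fintype.card F ^ e)).encard =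
            ((P.eval (Fintype.card F - 1) : ℕ) : ℕ∞)) ∧
    -- the explicit degrees and numbers of characters
    (∀ (F : Type u) [Field F] [Fintype F] (V : Type v) [AddCommGroup V] [Module F V]
        (n : ℕ) (b : Module.Basis (Fin n) F V) (β : LinearMap.BilinForm F V),
        2 < ringChar F →
          Even (altRank b β) ∧
          (∀ χ ∈ irrChars (GenHeisenberg β),
            χ 1 = 1 ∨ χ 1 = (Fintype.card F : ℂ) ^ (altRank b β / 2)) ∧
          (altRank b β ≠ 0 →
            (irrCharsOfDegree (GenHeisenberg β) 1).encard =
              ((Fintype.card F ^ n : ℕ) : ℕ∞) ∧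
            (irrCharsOfDegree (GenHeisenberg β) (Fintype.card F ^ (altRank b β / 2))).encard =
              (((Fintype.card F - 1) * Fintype.card F ^ (n - altRank b β) : ℕ) : ℕ∞)) ∧
          (altRank b β = 0 →
            (irrCharsOfDegree (GenHeisenberg β) 1).encard =
              ((Fintype.card F ^ n + (Fintype.card F - 1) * Fintype.card F ^ n : ℕ) : ℕ∞))) := by
  refine ⟨fun n r e => ?_, irrChars_description⟩
  open Polynomial in
  -- For `r = 0` the two families of characters share the degree `q ^ 0`.
  refine ⟨if e = 0 then (X + 1) ^ n + (if r = 0 then X * (X + 1) ^ n else 0)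
    else if e = r / 2 then X * (X + 1) ^ (n - r) else 0, ?_⟩
  rintro F _ _ V _ _ b β hF rfl
  obtain ⟨heven, hdeg, hne, hz⟩ := irrChars_description F V n b β hF
  have hq : 1 < Fintype.card F := Fintype.one_lt_card
  have hq' : Fintype.card F - 1 + 1 = Fintype.card F := by omega
  by_cases he : e = 0
  · subst he
    by_cases h0 : altRank b β = 0
    · simpa [h0, hq'] using hz h0
    · simpa [h0, hq'] using (hne h0).1
  by_cases her : e = altRank b β / 2
  · subst her
    simpa [he, hq'] using (hne (by rintro h; simp [h] at he)).2
  · -- The only degrees that occur are `q ^ 0` and `q ^ (r / 2)`.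
    have : irrCharsOfDegree (GenHeisenberg β) (Fintype.card F ^ e) = ∅ := by
      refine Set.eq_empty_of_forall_notMem fun χ hχ => ?_
      have h2 := hχ.2
      rcases hdeg χ hχ.1 with h | h <;> rw [h] at h2 <;> norm_cast at h2
      · exact (Nat.one_lt_pow he hq).ne h2
      · exact her (Nat.pow_right_injective hq h2).symm
    simp [he, her, this]
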